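/- Let $G=(V,E)$ be a finite simple graph. A \emph{Pauli string} of length $m$ is a tensor product of $m$ matrices from $\{\mathbb{1},X,Y,Z\}$ acting on $(\mathbb{C}^2)^{\otimes m}$; any two Pauli strings either commute or anticommute. A \emph{realization} of $G$ is a family $(S_i)_{i\in V}$ of Pauli strings of a common length such that, for all $i,j\in V$, $S_i$ and $S_j$ anticommute if and only if $i$ and $j$ are adjacent (every finite graph has a realization). For $w\in\mathbb{R}_{\ge 0}^V$ the \emph{weighted beta number} is $$\beta(G,w)=\sup_{\rho}\sum_{i\in V} w_i\,\bigl(\operatorname{tr}(\rho S_i)\bigr)^2,$$ the supremum being over all density matrices $\rho$ (positive semidefinite, trace one). This value is known not to depend on the realization $(S_i)$; equivalently, one may also take the supremum over all realizations. The \emph{weighted independence number} is $\alpha(G,w)=\max_{I}\sum_{i\in I}w_i$, the maximum being over all independent sets $I\subseteq V$. The graph $G$ is called \emph{$\hbar$-perfect} if $\beta(G,w)=\alpha(G,w)$ for every $w\in\mathbb{R}_{\ge 0}^V$. For finite simple graphs $G_1=(V_1,E_1)$ and $G_2=(V_2,E_2)$, the \emph{lexicographic product} $G_1[G_2]$ has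 vertex set $V_1\times V_2$, with $(i,j)$ and $(i',j')$ adjacent if and only if $i$ and $i'$ are adjacent in $G_1$, or $i=i'$ and $j$ and $j'$ are adjacent in $G_2$. \textbf{Theorem.} Let $G_1$ and $G_2$ be finite simple graphs. (a) For every $w=(w_{ij})\in\mathbb{R}_{\ge 0}^{V_1\times V_2}$, $$\beta(G_1[G_2],w)\le \beta\Bigl(G_1,\bigl(\beta(G_2,(w_{ij})_{j\in V_2})\bigr)_{i\in V_1}\Bigr).$$ (b) If $G_1$ and $G_2$ are $\hbar$-perfect, then $G_1[G_2]$ is $\hbar$-perfect. -/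

import Mathlib

open scoped Matrix ComplexOrder

/-- Labels of the four single-qubit Pauli matrices (the identity included). -/
inductive Pauli where
  | I | X | Y | Z
  deriving DecidableEq

/-- The `2 × 2` Pauli matrices. -/
def Pauli.mat : Pauli → Matrix (Fin 2) (Fin 2) ℂ
  | .I => 1
  | .X => !![0, 1; 1, 0]
  | .Y => !![0, -Complex.I; Complex.I, 0]
  | .Z => !![1, 0; 0, -1]

/-- A Pauli string of length `m`. -/
abbrev PauliString (m : ℕ) : Type := Fin m → Pauli

/-- The matrix of a Pauli string: the tensor product of its `m` Pauli factors, acting on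
`(ℂ²)^{⊗ m}`, whose computational basis is indexed by `Fin m → Fin 2`. -/
def PauliString.mat {m : ℕ} (S : PauliString m) :
    Matrix (Fin m → Fin 2) (Fin m → Fin 2) ℂ :=
  Matrix.of fun a b => ∏ k, (S k).mat (a k) (b k)

theorem Pauli.mat_mul_self (p : Pauli) : p.mat * p.mat = 1 := by
  cases p <;> ext i j <;> fin_cases i <;> fin_cases j <;> simp [Pauli.mat]

theorem PauliString.mat_mul_apply {m : ℕ} (S T : PauliString m) (a b : Fin m → Fin 2) :
    (S.mat * T.mat) a b = ∏ k, ((S k).mat * (T k).mat) (a k) (b k) := by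
  simp only [Matrix.mul_apply, PauliString.mat, Matrix.of_apply, ← Finset.prod_mul_distrib]
  rw [Finset.prod_univ_sum]
  simp

theorem PauliString.mat_mul_self {m : ℕ} (S : PauliString m) : S.mat * S.mat = 1 := by
  ext a b
  rw [PauliString.mat_mul_apply]
  simp only [Pauli.mat_mul_self, Matrix.one_apply]
  by_cases h : a = b
  · simp [h]
  · obtain ⟨k, hk⟩ := Function.ne_iff.mp h
    rw [if_neg h]
    exact Finset.prod_eq_zero (Finset.mem_univ k) (if_neg hk)

theorem PauliString.mat_mul_ne_zero {m : ℕ} (S T : PauliString m) : S.mat * T.mat ≠ 0 := by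
  intro h
  have h2 : S.mat * (S.mat * T.mat) * T.mat = 1 := by
    rw [← mul_assoc, S.mat_mul_self, one_mul, T.mat_mul_self]
  rw [h, mul_zero, zero_mul] at h2
  exact zero_ne_one h2

/-- Two strings cannot both commute and anticommute. -/
theorem PauliString.not_anticommute {m : ℕ} {S T : PauliString m}
    (h : S.mat * T.mat = T.mat * S.mat) : S.mat * T.mat ≠ -(T.mat * S.mat) := by
  intro h'
  rw [← h] at h'
  refine PauliString.mat_mul_ne_zero S T ?_
  ext a b
  exact self_eq_neg.mp (congrFun (congrFun h' a) b)

theorem PauliString.mat_mul_comm_sign {m : ℕ} {S T : PauliString m} (ε : Fin m → ℂ)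
    (h : ∀ k, (S k).mat * (T k).mat = ε k • ((T k).mat * (S k).mat)) :
    S.mat * T.mat = (∏ k, ε k) • (T.mat * S.mat) := by
  ext a b
  rw [Matrix.smul_apply, PauliString.mat_mul_apply, PauliString.mat_mul_apply, smul_eq_mul,
    ← Finset.prod_mul_distrib]
  refine Finset.prod_congr rfl fun k _ => ?_
  rw [h k, Matrix.smul_apply, smul_eq_mul]

/-- The frustration graph of a family of Pauli strings: `i` and `j` are adjacent exactly when
the strings `S i` and `S j` anticommute. -/
def frustrationGraph {V : Type*} {m : ℕ} (S : V → PauliString m) : SimpleGraph V where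
  Adj i j := (S i).mat * (S j).mat = -((S j).mat * (S i).mat)
  symm := ⟨fun i j h => by rw [h, neg_neg]⟩
  loopless := ⟨fun _ h => PauliString.not_anticommute rfl h⟩

/-- A realization of the graph `G` by Pauli strings: a family of Pauli strings of a common length,
indexed by the vertices, with frustration graph `G`. -/
structure PauliRealization {V : Type*} (G : SimpleGraph V) where
  /-- the common length of the strings -/
  length : ℕ
  /-- the strings -/
  string : V → PauliString length
  /-- the frustration graph of the strings is `G` -/
  frustrationGraph_eq : frustrationGraph string = G

/-- Every finite graph is a frustration graph, so that the weighted beta number below is a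
supremum over a nonempty family. -/
theorem PauliRealization.nonempty {V : Type*} [Fintype V] (G : SimpleGraph V) :
    Nonempty (PauliRealization G) := by
  classical
  let e : V ≃ Fin (Fintype.card V) := Fintype.equivFin V
  let S : V → PauliString (Fintype.card V) := fun i k =>
    if k = e i then .X else if k < e i ∧ G.Adj i (e.symm k) then .Z else .I
  have key : ∀ i j : V, e i < e j →
      (S i).mat * (S j).mat =
        (if G.Adj i j then (-1 : ℂ) else 1) • ((S j).mat * (S i).mat) := by
    intro i j hij
    have hp := PauliString.mat_mul_comm_sign (S := S i) (T := S j)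
      (fun k => if k = e i then (if G.Adj i j then (-1 : ℂ) else 1) else 1) (by
        intro k
        have hXZ : Pauli.X.mat * Pauli.Z.mat = (-1 : ℂ) • (Pauli.Z.mat * Pauli.X.mat) := by
          ext a b; fin_cases a <;> fin_cases b <;> simp [Pauli.mat]
        by_cases h1 : k = e i
        · subst h1
          by_cases h2 : G.Adj i j
          · simp [S, hij, hij.ne, h2, h2.symm, hXZ]
          · have h3 : ¬ G.Adj j i := fun h => h2 h.symm
            simp [S, hij.ne, h2, h3, Pauli.mat]
        · by_cases h2 : k = e j
          · subst h2
            simp [S, hij.ne', hij.not_gt, Pauli.mat]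
          · simp only [S, h1, h2, if_false, one_smul]
            split_ifs <;> simp [Pauli.mat])
    rw [hp]
    simp
  refine ⟨⟨_, S, ?_⟩⟩
  have key' : ∀ i j : V, e i < e j → ((frustrationGraph S).Adj i j ↔ G.Adj i j) := by
    intro i j hij
    have h := key i j hij
    by_cases h2 : G.Adj i j
    · rw [if_pos h2, neg_one_smul] at h
      exact iff_of_true h h2
    · rw [if_neg h2, one_smul] at h
      exact iff_of_false (PauliString.not_anticommute h) h2
  ext i j
  rcases lt_trichotomy (e i) (e j) with h | h | h
  · exact key' i j h
  · rw [e.injective h]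
    simp
  · rw [SimpleGraph.adj_comm, key' j i h, SimpleGraph.adj_comm]

/-- Density matrices on `ℂ^ι`: positive semidefinite matrices of trace one. -/
def IsDensityMatrix {ι : Type*} [Fintype ι] (ρ : Matrix ι ι ℂ) : Prop :=
  ρ.PosSemidef ∧ ρ.trace = 1

/-- The expectation value `⟨A⟩_ρ = tr (ρ A)` of an observable (a Hermitian matrix, so that the
trace is a real number). -/
noncomputable def expectation {ι : Type*} [Fintype ι] (ρ A : Matrix ι ι ℂ) : ℝ :=
  (ρ * A).trace.re

/-- The supremum of `∑ i, w i * ⟨S i⟩_ρ ^ 2` over all density matrices `ρ`, for a given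
realization `(S i)` of `G`. -/
noncomputable def PauliRealization.beta {V : Type*} [Fintype V] {G : SimpleGraph V}
    (R : PauliRealization G) (w : V → ℝ) : ℝ :=
  ⨆ ρ : {ρ : Matrix (Fin R.length → Fin 2) (Fin R.length → Fin 2) ℂ // IsDensityMatrix ρ},
    ∑ i, w i * expectation ρ.1 (R.string i).mat ^ 2

/-- The weighted beta number `β(G, w)`. The value `R.beta w` is known to be the same for all
realizations `R` of `G`; taking the supremum over all of them makes `β(G, w)` a graph parameter
without a choice of realization. -/
noncomputable def weightedBeta {V : Type*} [Fintype V] (G : SimpleGraph V) (w : V → ℝ) : ℝ :=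
  ⨆ R : PauliRealization G, R.beta w

/-- The weighted independence number `α(G, w)`. -/
noncomputable def weightedAlpha {V : Type*} [Fintype V] (G : SimpleGraph V) (w : V → ℝ) : ℝ :=
  ⨆ s : {s : Finset V // G.IsIndepSet (s : Set V)}, ∑ i ∈ s.1, w i

/-- A graph is ħ-perfect if `β(G, w) = α(G, w)` for all nonnegative weights `w`. -/
def IsHbarPerfect {V : Type*} [Fintype V] (G : SimpleGraph V) : Prop :=
  ∀ w : V → ℝ, (∀ i, 0 ≤ w i) → weightedBeta G w = weightedAlpha G w

/-- The lexicographic product `G₁[G₂]`: every vertex of `G₁` is replaced by a copy of `G₂`. -/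
def lexProduct {V₁ V₂ : Type*} (G₁ : SimpleGraph V₁) (G₂ : SimpleGraph V₂) :
    SimpleGraph (V₁ × V₂) where
  Adj p q := G₁.Adj p.1 q.1 ∨ (p.1 = q.1 ∧ G₂.Adj p.2 q.2)
  symm := ⟨fun _ _ h => h.imp (fun h => h.symm) (fun h => ⟨h.1.symm, h.2.symm⟩)⟩
  loopless := ⟨fun _ h => h.elim (fun h => h.ne rfl) (fun h => h.2.ne rfl)⟩

/-!
A Hermitian family with the commutation pattern of a graph need not consist of Pauli strings for
the beta number to control it. Let `B i` be Hermitian contractions and `T i` a Pauli realization,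
both following the pattern of `G`. The signs cancel in `B i ⊗ T i`, so the operators
`1 + B i ⊗ T i` are positive and commute, and the partial trace of `ρ ⊗ 1` against their product is
a state in which each `T i` has the expectation that `B i` has in `ρ`. Products of several `T i`
could contribute further terms; appending to every `T i` a `Z` on a qubit of its own makes all of
these traceless. Hence `∑ i, w i * ⟨B i⟩ ^ 2 ≤ β(G, w)`.

For `G₁[G₂]`, the Cauchy–Schwarz optimal combination of the strings in the fiber over `i`,
normalized using the beta number of the fiber, is a contraction, and these combinations follow the
pattern of `G₁`; applying the bound to them gives (a). The `0`-`1` family of an independent set is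
another family following the pattern of the graph, so `α ≤ β`, and (b) follows from (a) because
independent sets in the fibers over an independent set of `G₁` form one in `G₁[G₂]`.
-/

open scoped Kronecker MatrixOrder

section Pauli

/-- The sign relating the two products of a pair of Pauli matrices: `1` if they commute and `-1`
if they anticommute. -/
def Pauli.commSign (p q : Pauli) : ℤˣ :=
  if p = q ∨ p = .I ∨ q = .I then 1 else -1

/-- The sign relating the two products of a pair of Pauli strings: `1` if they commute and `-1`
if they anticommute. -/
def PauliString.commSign {m : ℕ} (S T : PauliString m) : ℤˣ :=
  ∏ k, (S k).commSign (T k)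

/-- The Pauli string with factor `p` at position `k` and the identity elsewhere. -/
def PauliString.single {m : ℕ} (k : Fin m) (p : Pauli) : PauliString m :=
  Function.update (fun _ => .I) k p

theorem Pauli.isHermitian_mat (p : Pauli) : p.mat.IsHermitian := by
  cases p <;> ext i j <;> fin_cases i <;> fin_cases j <;> simp [Pauli.mat]

theorem Pauli.mat_mul_eq_commSign_smul (p q : Pauli) :
    p.mat * q.mat = ((p.commSign q : ℤ) : ℂ) • (q.mat * p.mat) := by
  cases p <;> cases q <;> simp [Pauli.mat, Pauli.commSign]

namespace PauliString

variable {m n : ℕ}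

theorem isHermitian_mat (S : PauliString m) : S.mat.IsHermitian := by
  ext a b
  simp only [mat, Matrix.conjTranspose_apply, Matrix.of_apply, star_prod]
  exact Finset.prod_congr rfl fun k _ => (S k).isHermitian_mat.apply _ _

theorem mat_mul_eq_commSign_smul (S T : PauliString m) :
    S.mat * T.mat = ((S.commSign T : ℤ) : ℂ) • (T.mat * S.mat) := by
  have h := mat_mul_comm_sign _ fun k => (S k).mat_mul_eq_commSign_smul (T k)
  simpa only [commSign, Units.coe_prod, Int.cast_prod] using h

theorem commute_mat_of_commSign_eq_one {S T : PauliString m} (h : S.commSign T = 1) :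
    Commute S.mat T.mat := by
  simpa [h, Commute, SemiconjBy] using S.mat_mul_eq_commSign_smul T

theorem mat_mul_eq_neg_iff {S T : PauliString m} :
    S.mat * T.mat = -(T.mat * S.mat) ↔ S.commSign T = -1 := by
  refine ⟨fun h => (Int.units_eq_one_or _).resolve_left fun h' => ?_, fun h => ?_⟩
  · exact not_anticommute (commute_mat_of_commSign_eq_one h') h
  · simpa [h] using S.mat_mul_eq_commSign_smul T

theorem commute_mat_of_not_anticommute {S T : PauliString m}
    (h : S.mat * T.mat ≠ -(T.mat * S.mat)) : Commute S.mat T.mat :=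
  commute_mat_of_commSign_eq_one
    ((Int.units_eq_one_or _).resolve_right (mt mat_mul_eq_neg_iff.mpr h))

theorem commSign_append (S S' : PauliString m) (T T' : PauliString n) :
    commSign (Fin.append S T) (Fin.append S' T') = S.commSign S' * T.commSign T' := by
  simp [commSign, Fin.prod_univ_add]

theorem commSign_const_I (S : PauliString m) : commSign (fun _ => .I) S = 1 := by
  simp [commSign, Pauli.commSign]

theorem commSign_single_single (k l : Fin m) (p q : Pauli) :
    (single k p).commSign (single l q) = if k = l then p.commSign q else 1 := by
  rw [commSign, Finset.prod_eq_single k]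
  · by_cases h : k = l <;> simp [single, Pauli.commSign, h]
  · intro x _ hx
    simp [single, hx, Pauli.commSign]
  · simp

end PauliString

end Pauli

section GraphCommute

/-- The family `A` satisfies the relations that a graph `G` prescribes for its realizations:
members at adjacent vertices anticommute, all other pairs commute. Unlike for Pauli strings, both
relations may hold at once (for instance if some `A i` vanishes). -/
structure GraphCommute {V R : Type*} [NonUnitalNonAssocRing R] (G : SimpleGraph V) (A : V → R) :
    Prop where
  anticommute : ∀ {i j}, G.Adj i j → A i * A j = -(A j * A i)
  commute : ∀ {i j}, ¬ G.Adj i j → Commute (A i) (A j)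

variable {V V₁ V₂ R : Type*} {G : SimpleGraph V} {G₁ : SimpleGraph V₁} {G₂ : SimpleGraph V₂}

theorem PauliRealization.adj_iff (P : PauliRealization G) {i j : V} :
    G.Adj i j ↔ (P.string i).mat * (P.string j).mat = -((P.string j).mat * (P.string i).mat) := by
  simp only [← P.frustrationGraph_eq, frustrationGraph]

theorem PauliRealization.graphCommute (P : PauliRealization G) :
    GraphCommute G fun i => (P.string i).mat where
  anticommute h := P.adj_iff.mp h
  commute h := PauliString.commute_mat_of_not_anticommute (mt P.adj_iff.mpr h)

theorem graphCommute_indicator_one [Ring R] {s : Set V} (hs : G.IsIndepSet s) :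
    GraphCommute G (s.indicator (1 : V → R)) where
  anticommute {i j} h := by
    by_cases hi : i ∈ s
    · have hj : j ∉ s := fun hj => hs hi hj h.ne h
      simp [hj]
    · simp [hi]
  commute {i j} _ := by
    by_cases hi : i ∈ s <;> simp [hi]

theorem GraphCommute.commute_kronecker {n κ : Type*} [Fintype n] [Fintype κ] [CommRing R]
    {B : V → Matrix n n R} {T : V → Matrix κ κ R} (hB : GraphCommute G B) (hT : GraphCommute G T)
    (i j : V) : Commute (B i ⊗ₖ T i) (B j ⊗ₖ T j) := by
  rw [Commute, SemiconjBy, ← Matrix.mul_kronecker_mul, ← Matrix.mul_kronecker_mul]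
  by_cases h : G.Adj i j
  · rw [hB.anticommute h, hT.anticommute h]
    ext
    simp
  · rw [hB.commute h, hT.commute h]

namespace GraphCommute

variable [Ring R] {A : V₁ × V₂ → R}

theorem lexProduct_fiber (hA : GraphCommute (lexProduct G₁ G₂) A) (i : V₁) :
    GraphCommute G₂ fun j => A (i, j) where
  anticommute h := hA.anticommute (Or.inr ⟨rfl, h⟩)
  commute h := hA.commute (by simpa [lexProduct] using h)

theorem lexProduct_sum_smul [Fintype V₂] {𝕜 : Type*} [CommSemiring 𝕜] [Algebra 𝕜 R]
    (hA : GraphCommute (lexProduct G₁ G₂) A) (c : V₁ → V₂ → 𝕜) :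
    GraphCommute G₁ fun i => ∑ j, c i j • A (i, j) where
  anticommute {i i'} h := by
    rw [Finset.sum_mul_sum, Finset.sum_mul_sum, Finset.sum_comm, ← Finset.sum_neg_distrib]
    refine Finset.sum_congr rfl fun j' _ => ?_
    rw [← Finset.sum_neg_distrib]
    refine Finset.sum_congr rfl fun j _ => ?_
    rw [smul_mul_smul_comm, smul_mul_smul_comm, hA.anticommute (Or.inl h), smul_neg, mul_comm]
  commute {i i'} h := by
    rcases eq_or_ne i i' with rfl | hne
    · exact Commute.refl _
    · refine Commute.sum_left _ _ _ fun j _ => Commute.sum_right _ _ _ fun j' _ => ?_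
      refine ((hA.commute ?_).smul_left _).smul_right _
      rintro (h' | h')
      · exact h h'
      · exact hne h'.1

end GraphCommute

end GraphCommute

section Flip

/-- A family of involutions `Q` flipping the signs of the members of the family `A` one at a time:
conjugation by `Q k` maps `A k` to `-A k` and fixes every other `A j`. -/
structure IsFlipFamily {V R : Type*} [Ring R] (Q A : V → R) : Prop where
  mul_self : ∀ k, Q k * Q k = 1
  anticommute : ∀ k, Q k * A k = -(A k * Q k)
  commute : ∀ {k j}, j ≠ k → Commute (Q k) (A j)

/-- Append to the string of each vertex a `Z` on a private qubit; the flip of that vertex is the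
`X` on the same qubit. -/
theorem PauliRealization.exists_isFlipFamily {V : Type*} [Finite V] (G : SimpleGraph V) :
    ∃ (P : PauliRealization G) (Q : V → PauliString P.length),
      IsFlipFamily (fun k => (Q k).mat) fun k => (P.string k).mat := by
  have := Fintype.ofFinite V
  classical
  obtain ⟨P⟩ := PauliRealization.nonempty G
  let e : V ≃ Fin (Fintype.card V) := Fintype.equivFin V
  let T : V → PauliString (P.length + Fintype.card V) := fun i =>
    Fin.append (P.string i) (PauliString.single (e i) .Z)
  let Q : V → PauliString (P.length + Fintype.card V) := fun i =>
    Fin.append (fun _ => .I) (PauliString.single (e i) .X)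
  have hTT (i j : V) : (T i).commSign (T j) = (P.string i).commSign (P.string j) := by
    simp [T, PauliString.commSign_append, PauliString.commSign_single_single, Pauli.commSign]
  have hQT (i j : V) : (Q i).commSign (T j) = if i = j then -1 else 1 := by
    simp [Q, T, PauliString.commSign_append, PauliString.commSign_const_I,
      PauliString.commSign_single_single, Pauli.commSign]
  refine ⟨⟨_, T, ?_⟩, Q, fun k => (Q k).mat_mul_self, fun k => ?_, fun {k j} hjk => ?_⟩
  · ext i j
    rw [P.adj_iff, PauliString.mat_mul_eq_neg_iff, ← hTT, ← PauliString.mat_mul_eq_neg_iff]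
    rfl
  · exact PauliString.mat_mul_eq_neg_iff.mpr (by simp [hQT])
  · exact PauliString.commute_mat_of_commSign_eq_one (by simp [hQT, hjk.symm])

variable {V R n κ : Type*} [CommRing R] [Fintype n] [DecidableEq n] [Fintype κ] [DecidableEq κ]

theorem IsFlipFamily.one_kronecker {Q T : V → Matrix κ κ R} (hQ : IsFlipFamily Q T)
    (B : V → Matrix n n R) :
    IsFlipFamily (fun k => (1 : Matrix n n R) ⊗ₖ Q k) fun k => B k ⊗ₖ T k where
  mul_self k := by
    rw [← Matrix.mul_kronecker_mul, hQ.mul_self, mul_one, Matrix.one_kronecker_one]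
  anticommute k := by
    rw [← Matrix.mul_kronecker_mul, ← Matrix.mul_kronecker_mul, hQ.anticommute]
    ext
    simp
  commute {k j} h := by
    rw [Commute, SemiconjBy, ← Matrix.mul_kronecker_mul, ← Matrix.mul_kronecker_mul,
      (hQ.commute h).eq, one_mul, mul_one]

theorem trace_eq_zero_of_anticommute [IsAddTorsionFree R] {A Q : Matrix n n R} (hQ : Q * Q = 1)
    (h : Q * A = -(A * Q)) : A.trace = 0 := by
  refine self_eq_neg.mp ?_
  calc A.trace = (Q * A * Q).trace := by rw [Matrix.trace_mul_cycle, hQ, one_mul]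
    _ = -A.trace := by rw [h, neg_mul, mul_assoc, hQ, mul_one, Matrix.trace_neg]

namespace IsFlipFamily

variable [IsAddTorsionFree R] {Q F : V → Matrix n n R} (hQ : IsFlipFamily Q F) {M : Matrix n n R}
include hQ

theorem trace_mul_noncommProd_one_add {s : Finset V}
    (comm : (s : Set V).Pairwise (Function.onFun Commute fun i => 1 + F i))
    (hM : ∀ k ∈ s, Commute (Q k) M) :
    (M * s.noncommProd (fun i => 1 + F i) comm).trace = M.trace := by
  induction s using Finset.cons_induction_on with
  | empty => simp
  | cons a s ha ih =>
    rw [Finset.noncommProd_cons]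
    set P := s.noncommProd (fun i => 1 + F i) _
    have hP : Commute (Q a) P := Finset.noncommProd_commute _ _ _ _ fun x hx =>
      (Commute.one_right _).add_right (hQ.commute (ne_of_mem_of_not_mem hx ha))
    have hMa : Commute (Q a) M := hM a (Finset.mem_cons_self a s)
    have h_flip : Q a * (M * (F a * P)) = -(M * (F a * P) * Q a) := by
      rw [hMa.left_comm, ← mul_assoc (Q a), hQ.anticommute, neg_mul, mul_assoc (F a), hP.eq]
      simp only [mul_neg, mul_assoc]
    rw [add_mul, one_mul, mul_add, Matrix.trace_add,
      trace_eq_zero_of_anticommute (hQ.mul_self a) h_flip, add_zero]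
    exact ih _ fun k hk => hM k (Finset.mem_cons_of_mem hk)

theorem trace_mul_noncommProd_one_add_of_mem {s : Finset V} {i : V} (hi : i ∈ s)
    (comm : (s : Set V).Pairwise (Function.onFun Commute fun i => 1 + F i))
    (hM : ∀ k ∈ s, k ≠ i → Commute (Q k) M) :
    (M * s.noncommProd (fun i => 1 + F i) comm).trace = (M * (1 + F i)).trace := by
  classical
  have comm' := comm.mono (Finset.coe_subset.mpr (Finset.erase_subset i s))
  rw [← Finset.mul_noncommProd_erase s hi _ comm comm', ← mul_assoc,
    hQ.trace_mul_noncommProd_one_add]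
  intro k hk
  have hki : k ≠ i := Finset.ne_of_mem_erase hk
  exact (hM k (Finset.mem_of_mem_erase hk) hki).mul_right
    ((Commute.one_right _).add_right (hQ.commute hki.symm))

end IsFlipFamily

end Flip

section LoewnerOrder

variable {V 𝕜 R n κ : Type*} [RCLike 𝕜]

theorem one_add_nonneg_of_mul_self_eq_one [Ring R] [PartialOrder R] [StarRing R]
    [StarOrderedRing R] [Module ℝ R] [PosSMulMono ℝ R] {a : R} (ha : IsSelfAdjoint a)
    (h : a * a = 1) : 0 ≤ 1 + a := by
  have h_sq : star (1 + a) * (1 + a) = (2 : ℝ) • (1 + a) := by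
    rw [star_add, star_one, ha.star_eq, mul_add, mul_one, add_mul, one_mul, h, two_smul]
    abel
  rw [← inv_smul_smul₀ (two_ne_zero (α := ℝ)) (1 + a), ← h_sq]
  exact smul_nonneg (by norm_num) (star_mul_self_nonneg _)

theorem mem_Icc_neg_one_one_of_mul_self_eq_one [Ring R] [PartialOrder R] [StarRing R]
    [StarOrderedRing R] [Module ℝ R] [PosSMulMono ℝ R] {a : R} (ha : IsSelfAdjoint a)
    (h : a * a = 1) : a ∈ Set.Icc (-1) 1 := by
  refine ⟨neg_le_iff_add_nonneg'.mpr (one_add_nonneg_of_mul_self_eq_one ha h), sub_nonneg.mp ?_⟩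
  rw [sub_eq_add_neg]
  exact one_add_nonneg_of_mul_self_eq_one ha.neg (by rw [neg_mul_neg, h])

theorem PauliString.mat_mem_Icc {m : ℕ} (S : PauliString m) : S.mat ∈ Set.Icc (-1) 1 :=
  mem_Icc_neg_one_one_of_mul_self_eq_one S.isHermitian_mat S.mat_mul_self

theorem noncommProd_nonneg [Ring R] [PartialOrder R] [StarRing R] [StarOrderedRing R]
    [TopologicalSpace R] [Algebra ℝ R] [NonUnitalContinuousFunctionalCalculus ℝ R IsSelfAdjoint]
    [NonnegSpectrumClass ℝ R] {s : Finset V} {a : V → R} (ha : ∀ i ∈ s, 0 ≤ a i)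
    (comm : (s : Set V).Pairwise (Function.onFun Commute a)) : 0 ≤ s.noncommProd a comm := by
  induction s using Finset.cons_induction_on with
  | empty => simp
  | cons i s hi ih =>
    rw [Finset.noncommProd_cons]
    exact Commute.mul_nonneg (ha i (Finset.mem_cons_self i s))
      (ih (fun j hj => ha j (Finset.mem_cons_of_mem hj)) _)
      (Finset.noncommProd_commute _ _ _ _ fun j hj => comm (Finset.mem_cons_self i s)
        (Finset.mem_cons_of_mem hj) (ne_of_mem_of_not_mem hj hi).symm)

theorem isHermitian_of_le_one [Finite n] [DecidableEq n] {A : Matrix n n 𝕜} (hA : A ≤ 1) :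
    A.IsHermitian := by
  have := Fintype.ofFinite n
  have h_sub : (1 - A).IsHermitian := (Matrix.nonneg_iff_posSemidef.mp (sub_nonneg.mpr hA)).1
  simpa using Matrix.isHermitian_one.sub h_sub

theorem kronecker_nonneg [Finite n] [Finite κ] {A : Matrix n n 𝕜} {B : Matrix κ κ 𝕜}
    (hA : 0 ≤ A) (hB : 0 ≤ B) : 0 ≤ A ⊗ₖ B :=
  have := Fintype.ofFinite n
  have := Fintype.ofFinite κ
  ((Matrix.nonneg_iff_posSemidef.mp hA).kronecker (Matrix.nonneg_iff_posSemidef.mp hB)).nonneg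

theorem one_add_kronecker_nonneg [Finite n] [Finite κ] [DecidableEq n] [DecidableEq κ]
    {A : Matrix n n 𝕜} {B : Matrix κ κ 𝕜} (hA : A ∈ Set.Icc (-1) 1) (hB : B ∈ Set.Icc (-1) 1) :
    0 ≤ 1 + A ⊗ₖ B := by
  have h_avg : 1 + A ⊗ₖ B =
      (2⁻¹ : ℝ) • ((1 + A) ⊗ₖ (1 + B) + (1 - A) ⊗ₖ (1 - B)) := by
    rw [← Matrix.one_kronecker_one]
    ext ⟨i, j⟩ ⟨k, l⟩
    simp only [Matrix.add_apply, Matrix.sub_apply, Matrix.smul_apply, Matrix.kronecker_apply,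
      RCLike.real_smul_eq_coe_mul]
    push_cast
    ring
  have := Fintype.ofFinite n
  have := Fintype.ofFinite κ
  rw [h_avg]
  refine smul_nonneg (by norm_num) (add_nonneg ?_ ?_)
  · exact kronecker_nonneg (neg_le_iff_add_nonneg'.mp hA.1) (neg_le_iff_add_nonneg'.mp hB.1)
  · exact kronecker_nonneg (sub_nonneg.mpr hA.2) (sub_nonneg.mpr hB.2)

variable [Fintype n]

theorem exists_eq_conjTranspose_mul_self {A : Matrix n n 𝕜} (hA : A.PosSemidef) :
    ∃ C : Matrix n n 𝕜, A = Cᴴ * C := by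
  classical
  exact CStarAlgebra.nonneg_iff_eq_star_mul_self.mp hA.nonneg

theorem trace_mul_nonneg {A B : Matrix n n 𝕜} (hA : A.PosSemidef) (hB : B.PosSemidef) :
    0 ≤ (A * B).trace := by
  obtain ⟨C, rfl⟩ := exists_eq_conjTranspose_mul_self hA
  rw [Matrix.mul_assoc, Matrix.trace_mul_comm]
  exact (hB.mul_mul_conjTranspose_same C).trace_nonneg

end LoewnerOrder

section PartialTrace

variable {n κ R 𝕜 : Type*} [Fintype n]

/-- The partial trace over the first factor of a matrix on a tensor product. -/
def partialTraceLeft [AddCommMonoid R] (M : Matrix (n × κ) (n × κ) R) : Matrix κ κ R :=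
  ∑ x, M.submatrix (Prod.mk x) (Prod.mk x)

theorem posSemidef_partialTraceLeft [Ring R] [PartialOrder R] [StarRing R] [AddLeftMono R]
    {M : Matrix (n × κ) (n × κ) R} (hM : M.PosSemidef) : (partialTraceLeft M).PosSemidef :=
  Matrix.posSemidef_sum _ fun _ _ => hM.submatrix _

variable [Fintype κ]

theorem trace_partialTraceLeft_mul [DecidableEq n] [CommSemiring R]
    (M : Matrix (n × κ) (n × κ) R) (A : Matrix κ κ R) :
    (partialTraceLeft M * A).trace = (M * ((1 : Matrix n n R) ⊗ₖ A)).trace := by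
  simp only [partialTraceLeft, Matrix.sum_mul, Matrix.trace_sum]
  simp [Matrix.trace, Matrix.mul_apply, Fintype.sum_prod_type, Matrix.one_apply]

variable [DecidableEq κ]

theorem trace_partialTraceLeft_kronecker_one_mul_mul [CommSemiring R] (C : Matrix n n R)
    (M : Matrix (n × κ) (n × κ) R) (A : Matrix κ κ R) :
    (partialTraceLeft ((C ⊗ₖ (1 : Matrix κ κ R)) * M) * A).trace = ((C ⊗ₖ A) * M).trace := by
  classical
  rw [trace_partialTraceLeft_mul, Matrix.trace_mul_comm, ← mul_assoc, ← Matrix.mul_kronecker_mul,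
    one_mul, mul_one]

theorem partialTraceLeft_kronecker_one_mul_comm [CommSemiring R] (C : Matrix n n R)
    (M : Matrix (n × κ) (n × κ) R) :
    partialTraceLeft ((C ⊗ₖ (1 : Matrix κ κ R)) * M) =
      partialTraceLeft (M * (C ⊗ₖ (1 : Matrix κ κ R))) := by
  ext a b
  suffices ∑ x, ∑ y, C x y * M (y, a) (x, b) = ∑ x, ∑ y, M (x, a) (y, b) * C y x by
    simpa [partialTraceLeft, Matrix.sum_apply, Matrix.mul_apply, Fintype.sum_prod_type,
      Matrix.one_apply] using this
  rw [Finset.sum_comm]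
  simp only [mul_comm]

theorem posSemidef_partialTraceLeft_kronecker_one_mul [RCLike 𝕜]
    {ρ : Matrix n n 𝕜} (hρ : ρ.PosSemidef) {P : Matrix (n × κ) (n × κ) 𝕜} (hP : P.PosSemidef) :
    (partialTraceLeft ((ρ ⊗ₖ (1 : Matrix κ κ 𝕜)) * P)).PosSemidef := by
  obtain ⟨C, rfl⟩ := exists_eq_conjTranspose_mul_self hρ
  have h_split : (Cᴴ * C) ⊗ₖ (1 : Matrix κ κ 𝕜) = (C ⊗ₖ 1)ᴴ * (C ⊗ₖ 1) := by
    rw [Matrix.conjTranspose_kronecker, ← Matrix.mul_kronecker_mul, Matrix.conjTranspose_one,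
      mul_one]
  rw [h_split, mul_assoc, Matrix.conjTranspose_kronecker, Matrix.conjTranspose_one,
    partialTraceLeft_kronecker_one_mul_comm]
  convert posSemidef_partialTraceLeft (hP.mul_mul_conjTranspose_same (C ⊗ₖ (1 : Matrix κ κ 𝕜)))
    using 2
  rw [Matrix.conjTranspose_kronecker, Matrix.conjTranspose_one]

end PartialTrace

section Expectation

variable {n V κ : Type*} [Fintype n]

theorem expectation_neg (ρ A : Matrix n n ℂ) : expectation ρ (-A) = -expectation ρ A := by
  simp [expectation]

theorem expectation_add (ρ A B : Matrix n n ℂ) :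
    expectation ρ (A + B) = expectation ρ A + expectation ρ B := by
  simp [expectation, mul_add]

theorem expectation_sum_smul {ι : Type*} (s : Finset ι) (ρ : Matrix n n ℂ) (c : ι → ℝ)
    (A : ι → Matrix n n ℂ) :
    expectation ρ (∑ j ∈ s, c j • A j) = ∑ j ∈ s, c j * expectation ρ (A j) := by
  simp [expectation, Matrix.mul_sum, Matrix.trace_sum]

theorem expectation_vecMulVec_self_star (x : n → ℂ) (A : Matrix n n ℂ) :
    expectation (Matrix.vecMulVec x (star x)) A = (star x ⬝ᵥ A *ᵥ x).re := by
  rw [expectation, Matrix.vecMulVec_mul, Matrix.trace_vecMulVec, dotProduct_comm,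
    ← Matrix.dotProduct_mulVec]

theorem expectation_nonneg {ρ A : Matrix n n ℂ} (hρ : ρ.PosSemidef) (hA : 0 ≤ A) :
    0 ≤ expectation ρ A :=
  (Complex.le_def.mp (trace_mul_nonneg hρ (Matrix.nonneg_iff_posSemidef.mp hA))).1

theorem expectation_nonneg_of_forall_isDensityMatrix {A : Matrix n n ℂ}
    (h : ∀ τ, IsDensityMatrix τ → 0 ≤ expectation τ A) {M : Matrix n n ℂ} (hM : M.PosSemidef) :
    0 ≤ expectation M A := by
  obtain ⟨t, ht, htr⟩ : ∃ t : ℝ, 0 ≤ t ∧ M.trace = t :=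
    ⟨M.trace.re, (Complex.le_def.mp hM.trace_nonneg).1,
      Complex.ext rfl (Complex.le_def.mp hM.trace_nonneg).2.symm⟩
  rcases ht.eq_or_lt with rfl | ht
  · simp [expectation, hM.trace_eq_zero_iff.mp (by simpa using htr)]
  · have hτ : IsDensityMatrix (t⁻¹ • M) := by
      refine ⟨hM.smul (by positivity), ?_⟩
      rw [Matrix.trace_smul, htr, Complex.real_smul, ← Complex.ofReal_mul, inv_mul_cancel₀ ht.ne',
        Complex.ofReal_one]
    have h_scale : expectation (t⁻¹ • M) A = t⁻¹ * expectation M A := by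
      simp [expectation, Matrix.trace_smul]
    exact (mul_nonneg_iff_of_pos_left (inv_pos.mpr ht)).mp (h_scale ▸ h _ hτ)

theorem nonneg_of_forall_expectation_nonneg {A : Matrix n n ℂ} (hA : A.IsHermitian)
    (h : ∀ τ, IsDensityMatrix τ → 0 ≤ expectation τ A) : 0 ≤ A := by
  refine (Matrix.PosSemidef.of_dotProduct_mulVec_nonneg hA fun x => ?_).nonneg
  have hx := expectation_nonneg_of_forall_isDensityMatrix h
    (Matrix.posSemidef_vecMulVec_self_star x)
  rw [expectation_vecMulVec_self_star] at hx
  exact Complex.le_def.mpr ⟨hx, (hA.im_star_dotProduct_mulVec_self x).symm⟩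

variable [DecidableEq n]

theorem IsDensityMatrix.expectation_one {ρ : Matrix n n ℂ} (hρ : IsDensityMatrix ρ) :
    expectation ρ 1 = 1 := by
  simp [expectation, hρ.2]

theorem IsDensityMatrix.expectation_sq_le_one {ρ A : Matrix n n ℂ} (hρ : IsDensityMatrix ρ)
    (hA : A ∈ Set.Icc (-1) 1) : expectation ρ A ^ 2 ≤ 1 := by
  have h_neg := expectation_nonneg hρ.1 (neg_le_iff_add_nonneg'.mp hA.1)
  have h_pos := expectation_nonneg hρ.1 (sub_nonneg.mpr hA.2)
  rw [sub_eq_add_neg, expectation_add, expectation_neg, hρ.expectation_one] at h_pos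
  rw [expectation_add, hρ.expectation_one] at h_neg
  rw [sq_le_one_iff_abs_le_one, abs_le]
  constructor <;> linarith

theorem mem_Icc_neg_one_one_of_forall_expectation_sq_le_one {A : Matrix n n ℂ}
    (hA : A.IsHermitian) (h : ∀ τ, IsDensityMatrix τ → expectation τ A ^ 2 ≤ 1) :
    A ∈ Set.Icc (-1) 1 := by
  have h_abs τ (hτ : IsDensityMatrix τ) := abs_le.mp ((sq_le_one_iff_abs_le_one _).mp (h τ hτ))
  constructor
  · refine neg_le_iff_add_nonneg'.mpr
      (nonneg_of_forall_expectation_nonneg (Matrix.isHermitian_one.add hA) fun τ hτ => ?_)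
    rw [expectation_add, hτ.expectation_one]
    linarith [(h_abs τ hτ).1]
  · refine sub_nonneg.mp
      (nonneg_of_forall_expectation_nonneg (Matrix.isHermitian_one.sub hA) fun τ hτ => ?_)
    rw [sub_eq_add_neg, expectation_add, expectation_neg, hτ.expectation_one]
    linarith [(h_abs τ hτ).2]

/-- The coefficients are the optimal ones in the Cauchy–Schwarz inequality, proportional to
`w j * expectation ρ (A j)`. When their normalizing constant vanishes, they are all `0` because
`0⁻¹ = 0`, and so is the sum on the right. -/
theorem exists_sum_smul_mem_Icc_mul_expectation_sq_eq {ι : Type*} [Fintype ι] {w : ι → ℝ}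
    (hw : ∀ j, 0 ≤ w j) {A : ι → Matrix n n ℂ} (hA : ∀ j, (A j).IsHermitian) {b : ℝ}
    (hb : ∀ τ, IsDensityMatrix τ → ∑ j, w j * expectation τ (A j) ^ 2 ≤ b)
    {ρ : Matrix n n ℂ} (hρ : IsDensityMatrix ρ) :
    ∃ c : ι → ℝ, ∑ j, c j • A j ∈ Set.Icc (-1) 1 ∧
      b * expectation ρ (∑ j, c j • A j) ^ 2 = ∑ j, w j * expectation ρ (A j) ^ 2 := by
  set q := ∑ j, w j * expectation ρ (A j) ^ 2
  have hq : 0 ≤ q := Finset.sum_nonneg fun j _ => mul_nonneg (hw j) (sq_nonneg _)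
  have hqb : 0 ≤ q * b := mul_nonneg hq (hq.trans (hb ρ hρ))
  let c : ι → ℝ := fun j => (√(q * b))⁻¹ * (w j * expectation ρ (A j))
  have h_exp (τ) : expectation τ (∑ j, c j • A j) ^ 2 =
      (q * b)⁻¹ * (∑ j, w j * expectation ρ (A j) * expectation τ (A j)) ^ 2 := by
    simp only [expectation_sum_smul, c, mul_assoc (√(q * b))⁻¹, ← Finset.mul_sum]
    rw [mul_pow, inv_pow, Real.sq_sqrt hqb]
  have h_cauchy_schwarz τ (hτ : IsDensityMatrix τ) :
      (∑ j, w j * expectation ρ (A j) * expectation τ (A j)) ^ 2 ≤ q * b :=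
    calc _ ≤ q * ∑ j, w j * expectation τ (A j) ^ 2 :=
          Finset.sum_sq_le_sum_mul_sum_of_sq_le_mul _
            (fun j _ => mul_nonneg (hw j) (sq_nonneg _))
            (fun j _ => mul_nonneg (hw j) (sq_nonneg _)) fun j _ => le_of_eq (by ring)
      _ ≤ q * b := mul_le_mul_of_nonneg_left (hb τ hτ) hq
  refine ⟨c, mem_Icc_neg_one_one_of_forall_expectation_sq_le_one ?_ fun τ hτ => ?_, ?_⟩
  · exact isSelfAdjoint_sum _ fun j _ => (IsSelfAdjoint.all (c j)).smul (hA j)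
  · rw [h_exp]
    exact inv_mul_le_one_of_le₀ (h_cauchy_schwarz τ hτ) hqb
  · have h_self : ∑ j, w j * expectation ρ (A j) * expectation ρ (A j) = q :=
      Finset.sum_congr rfl fun j _ => by ring
    rw [h_exp, h_self]
    rcases hq.eq_or_lt with hq0 | hq0
    · simp [← hq0]
    · have hb0 : 0 < b := hq0.trans_le (hb ρ hρ)
      field_simp

end Expectation

section Transfer

variable {n κ V R : Type*} [Fintype n] [Fintype κ]

theorem commute_one_kronecker [DecidableEq n] [CommSemiring R] (C : Matrix n n R)
    {Q A : Matrix κ κ R} (h : Commute Q A) : Commute ((1 : Matrix n n R) ⊗ₖ Q) (C ⊗ₖ A) := by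
  rw [Commute, SemiconjBy, ← Matrix.mul_kronecker_mul, ← Matrix.mul_kronecker_mul, h.eq, one_mul,
    mul_one]

variable [DecidableEq n] [DecidableEq κ]

theorem GraphCommute.pairwise_commute_one_add_kronecker [CommRing R] {G : SimpleGraph V}
    {B : V → Matrix n n R} {T : V → Matrix κ κ R} (hB : GraphCommute G B) (hT : GraphCommute G T)
    (s : Set V) : s.Pairwise (Function.onFun Commute fun i => 1 + B i ⊗ₖ T i) :=
  fun i _ j _ _ => (Commute.one_left _).add_left
    ((Commute.one_right _).add_right (hB.commute_kronecker hT i j))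

namespace IsFlipFamily

variable [CommRing R] [IsAddTorsionFree R] {T Q : V → Matrix κ κ R} (hQ : IsFlipFamily Q T)
  {B : V → Matrix n n R} (C : Matrix n n R) {s : Finset V}
  (comm : (s : Set V).Pairwise (Function.onFun Commute fun i => 1 + B i ⊗ₖ T i))
include hQ

theorem trace_kronecker_one_mul_noncommProd :
    ((C ⊗ₖ (1 : Matrix κ κ R)) * s.noncommProd (fun i => 1 + B i ⊗ₖ T i) comm).trace =
      Fintype.card κ * C.trace := by
  rw [(hQ.one_kronecker B).trace_mul_noncommProd_one_add comm
      fun k _ => commute_one_kronecker C (Commute.one_right _),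
    Matrix.trace_kronecker, Matrix.trace_one, mul_comm]

theorem trace_kronecker_mul_noncommProd {i : V} (hi : i ∈ s) (hTi : T i * T i = 1) :
    ((C ⊗ₖ T i) * s.noncommProd (fun i => 1 + B i ⊗ₖ T i) comm).trace =
      Fintype.card κ * (C * B i).trace := by
  have hTi_trace : (T i).trace = 0 :=
    trace_eq_zero_of_anticommute (hQ.mul_self i) (hQ.anticommute i)
  rw [(hQ.one_kronecker B).trace_mul_noncommProd_one_add_of_mem hi comm
      fun k _ hk => commute_one_kronecker C (hQ.commute hk.symm),
    mul_add, mul_one, Matrix.trace_add, ← Matrix.mul_kronecker_mul, hTi, Matrix.trace_kronecker,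
    Matrix.trace_kronecker, hTi_trace, Matrix.trace_one, mul_zero, zero_add, mul_comm]

end IsFlipFamily

/-- The state is the normalized partial trace of `ρ ⊗ 1` multiplied by the product of the commuting
positive operators `1 + B i ⊗ T i`. In the expectation of `T i` only the term `B i ⊗ T i` of that
product survives: the sign of every other term is reversed by some flip. -/
theorem exists_isDensityMatrix_forall_expectation_eq [Finite V] [Nonempty κ] {G : SimpleGraph V}
    {ρ : Matrix n n ℂ} (hρ : IsDensityMatrix ρ) {B : V → Matrix n n ℂ} (hBG : GraphCommute G B)
    (hB : ∀ i, B i ∈ Set.Icc (-1) 1) {T Q : V → Matrix κ κ ℂ} (hTG : GraphCommute G T)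
    (hT : ∀ i, (T i).IsHermitian) (hTT : ∀ i, T i * T i = 1) (hQ : IsFlipFamily Q T) :
    ∃ σ, IsDensityMatrix σ ∧ ∀ i, expectation σ (T i) = expectation ρ (B i) := by
  have := Fintype.ofFinite V
  have comm := hBG.pairwise_commute_one_add_kronecker hTG (Finset.univ : Finset V)
  let P := Finset.univ.noncommProd (fun i => 1 + B i ⊗ₖ T i) comm
  have hT_mem (i : V) : T i ∈ Set.Icc (-1) 1 :=
    mem_Icc_neg_one_one_of_mul_self_eq_one (hT i) (hTT i)
  have h_nonneg (i : V) : 0 ≤ 1 + B i ⊗ₖ T i := one_add_kronecker_nonneg (hB i) (hT_mem i)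
  have hP : 0 ≤ P := noncommProd_nonneg (fun i _ => h_nonneg i) comm
  let τ := partialTraceLeft ((ρ ⊗ₖ (1 : Matrix κ κ ℂ)) * P)
  have hτ : τ.PosSemidef :=
    posSemidef_partialTraceLeft_kronecker_one_mul hρ.1 (Matrix.nonneg_iff_posSemidef.mp hP)
  have h_trace : τ.trace = Fintype.card κ := by
    rw [← mul_one τ, trace_partialTraceLeft_kronecker_one_mul_mul,
      hQ.trace_kronecker_one_mul_noncommProd ρ comm, hρ.2, mul_one]
  have h_trace_mul (i : V) : (τ * T i).trace = Fintype.card κ * (ρ * B i).trace := by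
    rw [trace_partialTraceLeft_kronecker_one_mul_mul,
      hQ.trace_kronecker_mul_noncommProd ρ comm (Finset.mem_univ i) (hTT i)]
  have h_card : (Fintype.card κ : ℂ) ≠ 0 := Nat.cast_ne_zero.mpr Fintype.card_ne_zero
  refine ⟨(Fintype.card κ : ℂ)⁻¹ • τ, ⟨hτ.smul (by positivity), ?_⟩, fun i => ?_⟩
  · rw [Matrix.trace_smul, h_trace, smul_eq_mul, inv_mul_cancel₀ h_card]
  · rw [expectation, Matrix.smul_mul, Matrix.trace_smul, h_trace_mul, smul_eq_mul,
      inv_mul_cancel_left₀ h_card, expectation]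

end Transfer

section Beta

variable {V : Type*} [Fintype V] {G : SimpleGraph V} {w : V → ℝ}

namespace PauliRealization

variable (P : PauliRealization G) {ρ : Matrix (Fin P.length → Fin 2) (Fin P.length → Fin 2) ℂ}

theorem sum_mul_expectation_sq_le_sum (hw : ∀ i, 0 ≤ w i) (hρ : IsDensityMatrix ρ) :
    ∑ i, w i * expectation ρ (P.string i).mat ^ 2 ≤ ∑ i, w i :=
  Finset.sum_le_sum fun i _ =>
    mul_le_of_le_one_right (hw i) (hρ.expectation_sq_le_one (P.string i).mat_mem_Icc)

theorem sum_mul_expectation_sq_le_beta (hw : ∀ i, 0 ≤ w i) (hρ : IsDensityMatrix ρ) :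
    ∑ i, w i * expectation ρ (P.string i).mat ^ 2 ≤ P.beta w :=
  le_ciSup (f := fun τ : {τ // IsDensityMatrix τ} =>
      ∑ i, w i * expectation τ.1 (P.string i).mat ^ 2)
    ⟨∑ i, w i, Set.forall_mem_range.mpr fun τ => P.sum_mul_expectation_sq_le_sum hw τ.2⟩ ⟨ρ, hρ⟩

theorem beta_le_sum (hw : ∀ i, 0 ≤ w i) : P.beta w ≤ ∑ i, w i :=
  Real.iSup_le (fun τ => P.sum_mul_expectation_sq_le_sum hw τ.2)
    (Finset.sum_nonneg fun i _ => hw i)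

theorem beta_le_weightedBeta (hw : ∀ i, 0 ≤ w i) : P.beta w ≤ weightedBeta G w :=
  le_ciSup (f := fun P : PauliRealization G => P.beta w)
    ⟨∑ i, w i, Set.forall_mem_range.mpr fun P => P.beta_le_sum hw⟩ P

end PauliRealization

theorem weightedBeta_le {a : ℝ} (ha : 0 ≤ a)
    (h : ∀ (P : PauliRealization G) (ρ : Matrix (Fin P.length → Fin 2) (Fin P.length → Fin 2) ℂ),
      IsDensityMatrix ρ → ∑ i, w i * expectation ρ (P.string i).mat ^ 2 ≤ a) :
    weightedBeta G w ≤ a :=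
  Real.iSup_le (fun P => Real.iSup_le (fun ρ => h P ρ.1 ρ.2) ha) ha

theorem weightedBeta_nonneg (hw : ∀ i, 0 ≤ w i) : 0 ≤ weightedBeta G w :=
  Real.iSup_nonneg fun _ => Real.iSup_nonneg fun _ =>
    Finset.sum_nonneg fun i _ => mul_nonneg (hw i) (sq_nonneg _)

theorem GraphCommute.sum_mul_expectation_sq_le_weightedBeta {n : Type*} [Fintype n]
    [DecidableEq n] {B : V → Matrix n n ℂ} (hBG : GraphCommute G B)
    (hB : ∀ i, B i ∈ Set.Icc (-1) 1) (hw : ∀ i, 0 ≤ w i) {ρ : Matrix n n ℂ}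
    (hρ : IsDensityMatrix ρ) : ∑ i, w i * expectation ρ (B i) ^ 2 ≤ weightedBeta G w := by
  obtain ⟨P, Q, hQ⟩ := PauliRealization.exists_isFlipFamily G
  obtain ⟨σ, hσ, h_expectation⟩ := exists_isDensityMatrix_forall_expectation_eq hρ hBG hB
    P.graphCommute (fun i => (P.string i).isHermitian_mat) (fun i => (P.string i).mat_mul_self) hQ
  simp only [← h_expectation]
  exact (P.sum_mul_expectation_sq_le_beta hw hσ).trans (P.beta_le_weightedBeta hw)

theorem sum_le_weightedBeta_of_isIndepSet (hw : ∀ i, 0 ≤ w i) {s : Finset V}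
    (hs : G.IsIndepSet (s : Set V)) : ∑ i ∈ s, w i ≤ weightedBeta G w := by
  classical
  let B : V → Matrix Unit Unit ℂ := Set.indicator s 1
  have hB (i : V) : B i ∈ Set.Icc (-1) 1 :=
    ⟨(neg_nonpos.mpr zero_le_one).trans (Set.indicator_nonneg (fun _ _ => zero_le_one) i),
      Set.indicator_le_self' (fun _ _ => zero_le_one) i⟩
  have hρ : IsDensityMatrix (1 : Matrix Unit Unit ℂ) := ⟨.one, by simp⟩
  have h_expectation (i : V) : expectation 1 (B i) = if i ∈ s then 1 else 0 := by
    by_cases hi : i ∈ s <;> simp [B, expectation, hi]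
  calc ∑ i ∈ s, w i = ∑ i, w i * expectation 1 (B i) ^ 2 := by simp [h_expectation]
    _ ≤ weightedBeta G w :=
      (graphCommute_indicator_one hs).sum_mul_expectation_sq_le_weightedBeta hB hw hρ

theorem weightedAlpha_le_weightedBeta (hw : ∀ i, 0 ≤ w i) :
    weightedAlpha G w ≤ weightedBeta G w :=
  Real.iSup_le (fun s => sum_le_weightedBeta_of_isIndepSet hw s.2) (weightedBeta_nonneg hw)

end Beta

section Alpha

variable {V : Type*} [Fintype V] {G : SimpleGraph V}

theorem sum_le_weightedAlpha (w : V → ℝ) {s : Finset V} (hs : G.IsIndepSet (s : Set V)) :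
    ∑ i ∈ s, w i ≤ weightedAlpha G w :=
  le_ciSup (f := fun s : {s : Finset V // G.IsIndepSet (s : Set V)} => ∑ i ∈ s.1, w i)
    (Set.finite_range _).bddAbove ⟨s, hs⟩

theorem exists_isIndepSet_sum_eq_weightedAlpha (G : SimpleGraph V) (w : V → ℝ) :
    ∃ s : Finset V, G.IsIndepSet (s : Set V) ∧ ∑ i ∈ s, w i = weightedAlpha G w := by
  have : Nonempty {s : Finset V // G.IsIndepSet (s : Set V)} := ⟨⟨∅, by simp⟩⟩
  obtain ⟨⟨s, hs⟩, h_sum⟩ := exists_eq_ciSup_of_finite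
    (f := fun s : {s : Finset V // G.IsIndepSet (s : Set V)} => ∑ i ∈ s.1, w i)
  exact ⟨s, hs, h_sum⟩

end Alpha

section LexProduct

variable {V₁ V₂ : Type*} {G₁ : SimpleGraph V₁} {G₂ : SimpleGraph V₂}

theorem isIndepSet_lexProduct {s : Set V₁} {t : V₁ → Set V₂} (hs : G₁.IsIndepSet s)
    (ht : ∀ i ∈ s, G₂.IsIndepSet (t i)) :
    (lexProduct G₁ G₂).IsIndepSet {p | p.1 ∈ s ∧ p.2 ∈ t p.1} := by
  rintro ⟨i, j⟩ ⟨hi, hj⟩ ⟨i', j'⟩ ⟨hi', hj'⟩ - (h | ⟨h, h'⟩)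
  · exact hs hi hi' h.ne h
  · obtain rfl : i = i' := h
    exact ht i hi hj hj' h'.ne h'

variable [Fintype V₁] [Fintype V₂] {w : V₁ × V₂ → ℝ}

theorem weightedAlpha_weightedAlpha_le (w : V₁ × V₂ → ℝ) :
    weightedAlpha G₁ (fun i => weightedAlpha G₂ fun j => w (i, j)) ≤
      weightedAlpha (lexProduct G₁ G₂) w := by
  classical
  obtain ⟨s, hs, hs_sum⟩ := exists_isIndepSet_sum_eq_weightedAlpha G₁
    fun i => weightedAlpha G₂ fun j => w (i, j)
  choose t ht ht_sum using fun i =>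
    exists_isIndepSet_sum_eq_weightedAlpha G₂ fun j => w (i, j)
  let u : Finset (V₁ × V₂) := {p | p.1 ∈ s ∧ p.2 ∈ t p.1}
  have hu : (lexProduct G₁ G₂).IsIndepSet (u : Set (V₁ × V₂)) := by
    simpa [u] using isIndepSet_lexProduct hs fun i _ => ht i
  calc _ = ∑ i ∈ s, ∑ j ∈ t i, w (i, j) := by simp only [ht_sum, hs_sum]
    _ = ∑ p ∈ u, w p := (Finset.sum_finset_product u s t (by simp [u])).symm
    _ ≤ weightedAlpha (lexProduct G₁ G₂) w := sum_le_weightedAlpha w hu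

theorem GraphCommute.sum_mul_expectation_sq_le_weightedBeta_weightedBeta {n : Type*} [Fintype n]
    [DecidableEq n] {A : V₁ × V₂ → Matrix n n ℂ} (hAG : GraphCommute (lexProduct G₁ G₂) A)
    (hA : ∀ p, A p ∈ Set.Icc (-1) 1) (hw : ∀ p, 0 ≤ w p) {ρ : Matrix n n ℂ}
    (hρ : IsDensityMatrix ρ) :
    ∑ p, w p * expectation ρ (A p) ^ 2 ≤
      weightedBeta G₁ fun i => weightedBeta G₂ fun j => w (i, j) := by
  choose c hc_mem hc_eq using fun i => exists_sum_smul_mem_Icc_mul_expectation_sq_eq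
    (fun j => hw (i, j)) (fun j => isHermitian_of_le_one (hA (i, j)).2)
    (fun τ => (hAG.lexProduct_fiber i).sum_mul_expectation_sq_le_weightedBeta
      (fun j => hA (i, j)) fun j => hw (i, j)) hρ
  rw [Fintype.sum_prod_type]
  simp only [← hc_eq]
  exact (hAG.lexProduct_sum_smul c).sum_mul_expectation_sq_le_weightedBeta hc_mem
    (fun i => weightedBeta_nonneg fun j => hw (i, j)) hρ

theorem weightedBeta_lexProduct_le (hw : ∀ p, 0 ≤ w p) :
    weightedBeta (lexProduct G₁ G₂) w ≤
      weightedBeta G₁ fun i => weightedBeta G₂ fun j => w (i, j) :=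
  weightedBeta_le (weightedBeta_nonneg fun i => weightedBeta_nonneg fun j => hw (i, j))
    fun P _ hρ => P.graphCommute.sum_mul_expectation_sq_le_weightedBeta_weightedBeta
      (fun p => (P.string p).mat_mem_Icc) hw hρ

theorem isHbarPerfect_lexProduct (h₁ : IsHbarPerfect G₁) (h₂ : IsHbarPerfect G₂) :
    IsHbarPerfect (lexProduct G₁ G₂) := by
  refine fun w hw => le_antisymm ?_ (weightedAlpha_le_weightedBeta hw)
  calc weightedBeta (lexProduct G₁ G₂) w
      ≤ weightedBeta G₁ fun i => weightedBeta G₂ fun j => w (i, j) :=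
        weightedBeta_lexProduct_le hw
    _ = weightedAlpha G₁ fun i => weightedBeta G₂ fun j => w (i, j) :=
        h₁ _ fun i => weightedBeta_nonneg fun j => hw (i, j)
    _ = weightedAlpha G₁ fun i => weightedAlpha G₂ fun j => w (i, j) :=
        congrArg _ (funext fun i => h₂ _ fun j => hw (i, j))
    _ ≤ weightedAlpha (lexProduct G₁ G₂) w := weightedAlpha_weightedAlpha_le w

end LexProduct

theorem mainTheorem10 {V₁ V₂ : Type*} [Fintype V₁] [Fintype V₂]
    (G₁ : SimpleGraph V₁) (G₂ : SimpleGraph V₂) :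
    (∀ w : V₁ × V₂ → ℝ, (∀ p, 0 ≤ w p) →
      weightedBeta (lexProduct G₁ G₂) w
        ≤ weightedBeta G₁ (fun i => weightedBeta G₂ (fun j => w (i, j)))) ∧
    (IsHbarPerfect G₁ → IsHbarPerfect G₂ → IsHbarPerfect (lexProduct G₁ G₂)) :=
  ⟨fun _ => weightedBeta_lexProduct_le, isHbarPerfect_lexProduct⟩
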